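/- Let $p$ be a prime, let $\overline{\mathbb F}_p$ be an algebraic closure of $\mathbb F_p$, and let $\overline{\mathbb Z}$ be the ring of all algebraic integers in $\overline{\mathbb Q}$. Fix a prime $\mathfrak P$ of $\overline{\mathbb Z}$ above $p$, let $G_p\subset G_{\mathbb Q}=\mathrm{Gal}(\overline{\mathbb Q}/\mathbb Q)$ be its decomposition group (the stabilizer of $\mathfrak P$, with the topology induced by the Krull topology), and let $I_p\subset G_p$ be its inertia group (the elements acting trivially on $\overline{\mathbb Z}/\mathfrak P$). Fix an embedding $\iota:\overline{\mathbb Z}/\mathfrak P\to\overline{\mathbb F}_p$. For $n\ge 1$ choose $\varpi\in\overline{\mathbb Q}$ with $\varpi^{p^n-1}=p$; the fundamental characters of niveau $n$ are the characters $$\psi_{n,i}:I_p\to\overline{\mathbb F}_p^{\times},\qquad \psi_{n,i}(\sigma)=\iota\bigl(\sigma(\varpi)/\varpi \bmod \mathfrak P\bigr)^{p^{i-1}},\qquad i=1,\dots,n$$ (they do not depend on the choice of $\varpi$). Let $V$ be a simple $n$-dimensional $\overline{\mathbb F}_p[G_p]$-module ($n\ge 1$ finite), with the action of $G_p$ given by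 a representation $\rho:G_p\to\mathrm{GL}(V)$ that is continuous for the discrete topology on $\mathrm{GL}(V)$. Then there is a basis of $V$ in which $$\rho|_{I_p}=\begin{pmatrix}\varphi_1&&\\&\ddots&\\&&\varphi_n\end{pmatrix},$$ where $\varphi_1,\dots,\varphi_n:I_p\to\overline{\mathbb F}_p^\times$ are characters which, for some single $m\in\mathbb Z$, are equal to some permutation of $\psi_{n,1}^m,\dots,\psi_{n,n}^m$. -/

import Mathlib

open scoped NumberField Pointwise

/-- A fixed algebraic closure `ℚ̄` of `ℚ`. -/
abbrev Qbar : Type := AlgebraicClosure ℚ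

/-- The absolute Galois group `G_ℚ`; it carries the Krull topology. -/
abbrev GQ : Type := Gal(Qbar/ℚ)

/-- The ring `ℤ̄` of all algebraic integers. -/
abbrev Zbar : Type := 𝓞 Qbar

/-- The decomposition group `G_𝔓 ⊆ G_ℚ` of a prime `𝔓` of `ℤ̄`: the stabilizer of `𝔓`.
As a subgroup of `G_ℚ` it carries the subspace topology. -/
noncomputable abbrev decompositionGroup (𝔓 : Ideal Zbar) : Subgroup GQ :=
  MulAction.stabilizer GQ 𝔓

/-- The inertia group inside the decomposition group: the elements of `G_𝔓`
that act trivially on `ℤ̄ / 𝔓`. -/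
noncomputable abbrev inertiaGroup (𝔓 : Ideal Zbar) : Subgroup (decompositionGroup 𝔓) :=
  𝔓.inertia (decompositionGroup 𝔓)

theorem prime_pow_sub_one_pos (p : ℕ) [hp : Fact p.Prime] (n : ℕ) [NeZero n] :
    0 < p ^ n - 1 :=
  Nat.sub_pos_of_lt (Nat.one_lt_pow (NeZero.ne n) hp.out.one_lt)

theorem exists_uniformizerRoot (p : ℕ) [Fact p.Prime] (n : ℕ) [NeZero n] :
    ∃ x : Qbar, x ^ (p ^ n - 1) = (p : Qbar) :=
  IsAlgClosed.exists_pow_nat_eq _ (prime_pow_sub_one_pos p n)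

/-- A `(p ^ n - 1)`-st root `ϖ` of `p` in `ℚ̄`.  Another choice multiplies `ϖ` by a root of
unity, on which inertia acts trivially modulo `𝔓`, so the fundamental characters
below do not depend on the choice. -/
noncomputable def uniformizerRoot (p : ℕ) [Fact p.Prime] (n : ℕ) [NeZero n] : Qbar :=
  (exists_uniformizerRoot p n).choose

theorem uniformizerRoot_pow (p : ℕ) [Fact p.Prime] (n : ℕ) [NeZero n] :
    uniformizerRoot p n ^ (p ^ n - 1) = (p : Qbar) :=
  (exists_uniformizerRoot p n).choose_spec

theorem uniformizerRoot_ne_zero (p : ℕ) [hp : Fact p.Prime] (n : ℕ) [NeZero n] :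
    uniformizerRoot p n ≠ 0 := by
  intro h
  have h1 := uniformizerRoot_pow p n
  rw [h, zero_pow (prime_pow_sub_one_pos p n).ne'] at h1
  exact hp.out.ne_zero (by exact_mod_cast h1.symm)

theorem kummer_pow (p : ℕ) [hp : Fact p.Prime] (n : ℕ) [NeZero n] (σ : GQ) :
    (σ (uniformizerRoot p n) / uniformizerRoot p n) ^ (p ^ n - 1) = 1 := by
  have h0 : (p : Qbar) ≠ 0 := by exact_mod_cast hp.out.ne_zero
  rw [div_pow, ← map_pow, uniformizerRoot_pow, map_natCast, div_self h0]

/-- The root of unity `σ(ϖ) / ϖ`, of order dividing `p ^ n - 1`, as an algebraic integer. -/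
noncomputable def kummerRoot (p : ℕ) [Fact p.Prime] (n : ℕ) [NeZero n] (σ : GQ) : Zbar :=
  ⟨σ (uniformizerRoot p n) / uniformizerRoot p n,
    IsIntegral.of_pow (prime_pow_sub_one_pos p n) (by rw [kummer_pow]; exact isIntegral_one)⟩

theorem kummerRoot_one (p : ℕ) [Fact p.Prime] (n : ℕ) [NeZero n] :
    kummerRoot p n 1 = 1 := by
  apply NumberField.RingOfIntegers.ext
  exact div_self (uniformizerRoot_ne_zero p n)

theorem kummerRoot_mul (p : ℕ) [Fact p.Prime] (n : ℕ) [NeZero n] (σ τ : GQ) :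
    kummerRoot p n (σ * τ) = σ • kummerRoot p n τ * kummerRoot p n σ := by
  apply NumberField.RingOfIntegers.ext
  have h : σ (uniformizerRoot p n) ≠ 0 := by simpa using uniformizerRoot_ne_zero p n
  change σ (τ (uniformizerRoot p n)) / uniformizerRoot p n
    = σ (τ (uniformizerRoot p n) / uniformizerRoot p n) *
      (σ (uniformizerRoot p n) / uniformizerRoot p n)
  rw [map_div₀, div_mul_div_cancel₀ h]

/-- The tame character of level `n`, `σ ↦ σ(ϖ) / ϖ mod 𝔓` with `ϖ ^ (p ^ n - 1) = p`,
from inertia to the `(p ^ n - 1)`-st roots of unity (the group `𝔽_{p^n}ˣ`) of the residue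
field `ℤ̄ / 𝔓`. -/
noncomputable def tameCharacter (p : ℕ) [Fact p.Prime] (n : ℕ) [NeZero n]
    (𝔓 : Ideal Zbar) : inertiaGroup 𝔓 →* Zbar ⧸ 𝔓 where
  toFun σ := Ideal.Quotient.mk 𝔓 (kummerRoot p n ((σ : decompositionGroup 𝔓) : GQ))
  map_one' := by
    change Ideal.Quotient.mk 𝔓 (kummerRoot p n 1) = 1
    rw [kummerRoot_one, map_one]
  map_mul' σ τ := by
    have h : Ideal.Quotient.mk 𝔓
          (((σ : decompositionGroup 𝔓) : GQ) •
            kummerRoot p n ((τ : decompositionGroup 𝔓) : GQ))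
        = Ideal.Quotient.mk 𝔓 (kummerRoot p n ((τ : decompositionGroup 𝔓) : GQ)) :=
      Ideal.Quotient.eq.mpr (σ.2 _)
    change Ideal.Quotient.mk 𝔓 (kummerRoot p n
        (((σ : decompositionGroup 𝔓) : GQ) * ((τ : decompositionGroup 𝔓) : GQ))) = _
    rw [kummerRoot_mul, map_mul, h, mul_comm]

/-- The fundamental characters `ψ_{n,1}, …, ψ_{n,n} : I → 𝔽̄_pˣ` of niveau `n`, indexed from
`0`, relative to an embedding `ι` of the residue field `ℤ̄ / 𝔓` into `k = 𝔽̄_p`: the tame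
character of level `n`, followed by the `n` embeddings of `𝔽_{p^n}` into `k`, which are
`ι` composed with the powers `x ↦ x ^ (p ^ i)`, `0 ≤ i < n`, of the Frobenius
automorphism of `k`. -/
noncomputable def fundamentalCharacter (p : ℕ) [Fact p.Prime] (n : ℕ) [NeZero n]
    (𝔓 : Ideal Zbar) {k : Type*} [Field k] [CharP k p] (ι : Zbar ⧸ 𝔓 →+* k) (i : Fin n) :
    inertiaGroup 𝔓 →* kˣ :=
  MonoidHom.toHomUnits
    ((((iterateFrobenius k p i).comp ι : Zbar ⧸ 𝔓 →+* k) : Zbar ⧸ 𝔓 →* k).comp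
      (tameCharacter p n 𝔓))

/-! By continuity `ρ` factors through the image of the decomposition group in `Gal(L/ℚ)` for some
finite normal `L`, which may be taken to contain `ϖ`. At the prime `Q` of `L` below `𝔓`, inertia
acts on the line `Q / Q ^ 2` by a character `tameHom`, whose kernel is a `p`-group and whose image
is cyclic. A normal subgroup acting through a finite `p`-group has nonzero fixed vectors in
characteristic `p`, so by simplicity it acts trivially. Hence `ρ` of inertia consists of powers of
`T = ρ σ₀`, and a Frobenius `F` gives `T E = E T ^ p` with `E = ρ F⁻¹`.

So `E` carries the `a`-eigenspace of `T` into the `a ^ p`-eigenspace. If `d > 0` is least with `a ^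
p ^ d = a`, an eigenvector `v` of `E ^ d` in the `a`-eigenspace spans with `E v, …, E ^ (d - 1) v` a
stable subspace. Simplicity makes it all of `V`, so `d = n` and `a ^ (p ^ n - 1) = 1`
(`exists_basis_eigenvalues_prime_pow`).

Finally, comparing ramification with the valuation of `ϖ` shows that `σ₀(ϖ)/ϖ` is a primitive `(p ^
n - 1)`-st root of unity modulo `𝔓` (`isPrimitiveRoot_tameHom_pow`). Thus `a` is the `m`-th power of
its image in `k`, and its conjugates `a ^ p ^ i` give the powers of the fundamental characters. -/

/-! ### Inertia acting on `Q / Q ^ 2` in a Dedekind domain. -/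

section TameHom

variable {S G : Type*} [CommRing S] [Group G] [MulSemiringAction G S] {Q : Ideal S}

theorem smul_mem_pow_of_mem_stabilizer {σ : G} (hσ : σ ∈ MulAction.stabilizer G Q) {i : ℕ} {x : S}
    (hx : x ∈ Q ^ i) : σ • x ∈ Q ^ i := by
  have h : σ • Q ^ i = Q ^ i := by
    rw [smul_pow', MulAction.mem_stabilizer_iff.mp hσ]
  rw [← h]
  exact Ideal.smul_mem_pointwise_smul σ x _ hx

theorem smul_mem_pow_of_mem_inertia {σ : G} (hσ : σ ∈ Q.inertia G) {i : ℕ} {x : S}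
    (hx : x ∈ Q ^ i) : σ • x ∈ Q ^ i :=
  smul_mem_pow_of_mem_stabilizer (Ideal.inertia_le_stabilizer Q hσ) hx

/-- `Q ^ (i + 1)` is generated by products of elements of `Q ^ i` and `Q`, and scalars on the graded
pieces multiply. -/
theorem smul_sub_pow_mul_mem {σ : G} (hσ : σ ∈ Q.inertia G) {u : S}
    (hu : ∀ x ∈ Q, σ • x - u * x ∈ Q ^ 2) (i : ℕ) {x : S} (hx : x ∈ Q ^ i) :
    σ • x - u ^ i * x ∈ Q ^ (i + 1) := by
  induction i generalizing x with
  | zero => simpa using hσ x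
  | succ i ih =>
    rw [pow_succ] at hx
    induction hx using Submodule.mul_induction_on' with
    | mem_mul_mem a ha b hb =>
      have : σ • (a * b) - u ^ (i + 1) * (a * b) =
          σ • a * (σ • b - u * b) + (σ • a - u ^ i * a) * (u * b) := by
        rw [smul_mul']; ring
      rw [this]
      refine add_mem ?_ ?_
      · rw [show i + 1 + 1 = i + 2 from rfl, pow_add]
        exact Ideal.mul_mem_mul (smul_mem_pow_of_mem_inertia hσ ha) (hu b hb)
      · rw [pow_succ]
        exact Ideal.mul_mem_mul (ih ha) (Ideal.mul_mem_left _ _ hb)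
    | add a ha b hb iha ihb =>
      have : σ • (a + b) - u ^ (i + 1) * (a + b) =
          (σ • a - u ^ (i + 1) * a) + (σ • b - u ^ (i + 1) * b) := by
        rw [smul_add]; ring
      rw [this]
      exact add_mem iha ihb

variable [IsDedekindDomain S] [Q.IsPrime]

/-- `Q / Q ^ 2` is a line spanned by the class of `a`, and inertia acts on it `S ⧸ Q`-linearly, so
the scalar can be read off from `a`. -/
theorem smul_sub_mul_mem_sq {σ : G} (hσ : σ ∈ Q.inertia G) (hQ : Q ≠ ⊥) {a u x : S}
    (ha : a ∈ Q) (ha' : a ∉ Q ^ 2) (hu : σ • a - u * a ∈ Q ^ 2) (hx : x ∈ Q) :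
    σ • x - u * x ∈ Q ^ 2 := by
  obtain ⟨d, e, he, rfl⟩ := Ideal.exists_mul_add_mem_pow_succ hQ (i := 1) a x (by simpa using ha)
    ha' (by simpa using hx)
  have h1 : σ • e ∈ Q ^ 2 := smul_mem_pow_of_mem_inertia hσ he
  have h2 : a * (σ • d - d) ∈ Q ^ 2 := by
    rw [sq]; exact Ideal.mul_mem_mul ha (hσ d)
  have : σ • (a * d + e) - u * (a * d + e) =
      (σ • a - u * a) * σ • d + u * (a * (σ • d - d)) + σ • e - u * e := by
    rw [smul_add, smul_mul']; ring
  rw [this]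
  exact sub_mem (add_mem (add_mem (Ideal.mul_mem_right _ _ hu) (Ideal.mul_mem_left _ _ h2)) h1)
    (Ideal.mul_mem_left _ _ he)

theorem exists_mem_notMem_sq (hQ : Q ≠ ⊥) : ∃ a ∈ Q, a ∉ Q ^ 2 := by
  have := Ideal.pow_succ_lt_pow hQ 1
  obtain ⟨a, ha, ha'⟩ := SetLike.exists_of_lt this
  exact ⟨a, by simpa using ha, ha'⟩

theorem sub_mem_of_smul_sub_mem_sq {σ : G} (hQ : Q ≠ ⊥) {a u v : S} (ha' : a ∉ Q ^ 2)
    (hu : σ • a - u * a ∈ Q ^ 2) (hv : σ • a - v * a ∈ Q ^ 2) : u - v ∈ Q := by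
  refine Ideal.mem_prime_of_mul_mem_pow hQ (i := 1) ha' ?_
  have : a * (u - v) = (σ • a - v * a) - (σ • a - u * a) := by ring
  rw [this]
  exact sub_mem hv hu

/-- The action of the inertia group at `Q` on the `S ⧸ Q`-line `Q / Q ^ 2`. -/
theorem exists_tameHom (G : Type*) [Group G] [MulSemiringAction G S] (hQ : Q ≠ ⊥) :
    ∃ θ : Q.inertia G →* S ⧸ Q,
      ∀ σ u, Ideal.Quotient.mk Q u = θ σ → ∀ x ∈ Q, (σ : G) • x - u * x ∈ Q ^ 2 := by
  obtain ⟨a, ha, ha'⟩ := exists_mem_notMem_sq hQ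
  have hex (σ : Q.inertia G) : ∃ u : S, (σ : G) • a - u * a ∈ Q ^ 2 := by
    have h1 : (σ : G) • a ∈ Q ^ 1 := smul_mem_pow_of_mem_inertia σ.2 (by simpa using ha)
    obtain ⟨d, e, he, h⟩ := Ideal.exists_mul_add_mem_pow_succ hQ (i := 1) a _ (by simpa using ha)
      ha' h1
    exact ⟨d, by rw [← h]; convert! he using 1; ring⟩
  choose u hu using hex
  have key (σ : Q.inertia G) (v : S) (hv : (σ : G) • a - v * a ∈ Q ^ 2) :
      Ideal.Quotient.mk Q (u σ) = Ideal.Quotient.mk Q v :=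
    Ideal.Quotient.eq.mpr (sub_mem_of_smul_sub_mem_sq hQ ha' (hu σ) hv)
  refine ⟨⟨⟨fun σ ↦ Ideal.Quotient.mk Q (u σ), ?_⟩, fun σ τ ↦ ?_⟩, fun σ v hv x hx ↦ ?_⟩
  · rw [key 1 1 (by simp), map_one]
  · rw [← map_mul]
    apply key
    have h1 := smul_mem_pow_of_mem_inertia σ.2 (hu τ)
    have h2 : a * ((σ : G) • u τ - u τ) ∈ Q ^ 2 := by
      rw [sq]; exact Ideal.mul_mem_mul ha (σ.2 _)
    have : ((σ * τ : Q.inertia G) : G) • a - u σ * u τ * a =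
        (σ : G) • ((τ : G) • a - u τ * a) + ((σ : G) • a - u σ * a) * (σ : G) • u τ
          + u σ * (a * ((σ : G) • u τ - u τ)) := by
      rw [Subgroup.coe_mul, mul_smul, smul_sub, smul_mul']; ring
    rw [this]
    exact add_mem (add_mem h1 (Ideal.mul_mem_right _ _ (hu σ))) (Ideal.mul_mem_left _ _ h2)
  · refine smul_sub_mul_mem_sq σ.2 hQ ha ha' ?_ hx
    have h : u σ - v ∈ Q := Ideal.Quotient.eq.mp hv.symm
    have : (σ : G) • a - v * a = ((σ : G) • a - u σ * a) + (u σ - v) * a := by ring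
    rw [this]
    exact add_mem (hu σ) (by rw [sq]; exact Ideal.mul_mem_mul h ha)

/-- The tame character of the inertia group at a nonzero prime `Q` of a Dedekind domain:
the character by which it acts on `Q / Q ^ 2`. -/
noncomputable def tameHom (G : Type*) [Group G] [MulSemiringAction G S] (hQ : Q ≠ ⊥) :
    Q.inertia G →* S ⧸ Q :=
  (exists_tameHom G hQ).choose

theorem smul_sub_pow_mul_mem_of_mk_eq (hQ : Q ≠ ⊥) {σ : Q.inertia G} {u : S}
    (hu : Ideal.Quotient.mk Q u = tameHom G hQ σ) (i : ℕ) {x : S} (hx : x ∈ Q ^ i) :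
    (σ : G) • x - u ^ i * x ∈ Q ^ (i + 1) :=
  smul_sub_pow_mul_mem σ.2 ((exists_tameHom G hQ).choose_spec σ u hu) i hx

theorem mk_eq_tameHom (hQ : Q ≠ ⊥) {σ : Q.inertia G} {u : S}
    (hu : ∀ x ∈ Q, (σ : G) • x - u * x ∈ Q ^ 2) : Ideal.Quotient.mk Q u = tameHom G hQ σ := by
  obtain ⟨v, hv⟩ := Ideal.Quotient.mk_surjective (tameHom G hQ σ)
  obtain ⟨a, ha, ha'⟩ := exists_mem_notMem_sq hQ
  rw [← hv]
  refine Ideal.Quotient.eq.mpr (sub_mem_of_smul_sub_mem_sq hQ ha' (hu a ha) ?_)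
  simpa using smul_sub_pow_mul_mem_of_mk_eq hQ hv 1 (x := a) (by simpa using ha)

/-- An element of the stabilizer acts on tame characters through its action on the
residue field. -/
theorem tameHom_conj (hQ : Q ≠ ⊥) {F : G} (hF : F ∈ MulAction.stabilizer G Q)
    {σ τ : Q.inertia G} (hτ : (τ : G) = F * σ * F⁻¹) {u : S}
    (hu : Ideal.Quotient.mk Q u = tameHom G hQ σ) :
    tameHom G hQ τ = Ideal.Quotient.mk Q (F • u) := by
  refine (mk_eq_tameHom hQ fun x hx ↦ ?_).symm
  have hx' : F⁻¹ • x ∈ Q ^ 1 :=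
    smul_mem_pow_of_mem_stabilizer (inv_mem hF) (by simpa using hx)
  have h := smul_mem_pow_of_mem_stabilizer hF (smul_sub_pow_mul_mem_of_mk_eq hQ hu 1 hx')
  simpa [hτ, mul_smul, smul_sub, smul_mul'] using h

/-- Here `σ` is trivial on every graded piece. If `y = σ x - x` lies in `Q ^ i`, then `σ ^ j x ≡ x +
j y` modulo `Q ^ (i + 1)`; at `j = l` this gives `l y ∈ Q ^ (i + 1)`, and `l` is invertible modulo
`Q`. So `y` lies in every power of `Q`, hence is zero by Krull's intersection theorem. -/
theorem smul_eq_self_of_tameHom_eq_one (hQ : Q ≠ ⊥) {σ : Q.inertia G}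
    (hσ : tameHom G hQ σ = 1) {l : ℕ} (hl : (l : S) ∉ Q) (hσl : σ ^ l = 1) (x : S) :
    (σ : G) • x = x := by
  have hpow (i : ℕ) {y : S} (hy : y ∈ Q ^ i) : (σ : G) • y - y ∈ Q ^ (i + 1) := by
    simpa using smul_sub_pow_mul_mem_of_mk_eq hQ (u := 1) (by rw [hσ, map_one]) i hy
  have hmem (i : ℕ) : (σ : G) • x - x ∈ Q ^ i := by
    induction i with
    | zero => simp
    | succ i ih =>
      set y := (σ : G) • x - x with hy
      have hiter (j : ℕ) : ((σ : G) ^ j) • x - x - j * y ∈ Q ^ (i + 1) := by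
        induction j with
        | zero => simp
        | succ j ihj =>
          have e1 : ((σ : G) ^ (j + 1)) • x - x - (j + 1 : ℕ) * y =
              (σ : G) • ((σ : G) ^ j • x - x - j * y) + j * ((σ : G) • y - y) := by
            rw [pow_succ', mul_smul, smul_sub, smul_sub, smul_mul', hy]
            have : (σ : G) • (j : S) = j := map_natCast (MulSemiringAction.toRingHom G S σ) j
            rw [this]; push_cast; ring
          rw [e1]
          exact add_mem (smul_mem_pow_of_mem_inertia σ.2 ihj) (Ideal.mul_mem_left _ _ (hpow i ih))
      have h := hiter l
      rw [← Subgroup.coe_pow, hσl, Subgroup.coe_one, one_smul, sub_self, zero_sub,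
        Submodule.neg_mem_iff] at h
      by_contra hcon
      exact hl (Ideal.mem_prime_of_mul_mem_pow hQ hcon (by rwa [mul_comm]))
  have hbot : (σ : G) • x - x ∈ (⨅ i : ℕ, Q ^ i : Ideal S) := by
    simpa [Submodule.mem_iInf] using hmem
  rw [Ideal.iInf_pow_eq_bot_of_isDomain Q (Ideal.IsPrime.ne_top inferInstance)] at hbot
  exact sub_eq_zero.mp hbot

theorem isPGroup_ker_tameHom [Finite G] [FaithfulSMul G S] (hQ : Q ≠ ⊥) {p : ℕ}
    [hp : Fact p.Prime] (hpQ : (p : S) ∈ Q) : IsPGroup p (tameHom G hQ).ker := by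
  rw [isPGroup_iff_pow_pow_eq_one]
  rintro ⟨σ, hσ⟩
  -- With `m` the prime-to-`p` part of the order, `σ ^ p ^ k` is killed by `m` and hence trivial.
  obtain ⟨k, m, hm, hkm⟩ := Nat.exists_eq_pow_mul_and_not_dvd (orderOf_pos σ).ne' p hp.out.ne_one
  refine ⟨k, ?_⟩
  have hmQ : (m : S) ∉ Q := by
    intro h
    obtain ⟨a, b, hab⟩ := (Nat.isCoprime_iff_coprime.mpr
      ((Nat.Prime.coprime_iff_not_dvd hp.out).mpr hm))
    refine (Ideal.ne_top_iff_one Q).mp (Ideal.IsPrime.ne_top inferInstance) ?_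
    have : (1 : S) = (a : S) * (p : S) + (b : S) * (m : S) := by
      exact_mod_cast congrArg (Int.cast (R := S)) hab.symm
    rw [this]
    exact add_mem (Ideal.mul_mem_left _ _ hpQ) (Ideal.mul_mem_left _ _ h)
  have h1 : tameHom G hQ (σ ^ p ^ k) = 1 := by
    rw [map_pow, (MonoidHom.mem_ker).mp hσ, one_pow]
  have h2 : (σ ^ p ^ k) ^ m = 1 := by rw [← pow_mul, ← hkm, pow_orderOf_eq_one]
  apply Subtype.ext
  change σ ^ p ^ k = 1
  apply Subtype.ext
  refine FaithfulSMul.eq_of_smul_eq_smul (α := S) fun x ↦ ?_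
  rw [smul_eq_self_of_tameHom_eq_one hQ h1 hmQ h2]
  simp

end TameHom

/-! ### Cyclic tame inertia and the ramification index. -/

section TameGenerator

variable {S G : Type*} [CommRing S] [IsDedekindDomain S] [Group G] [MulSemiringAction G S]
  {Q : Ideal S} [Q.IsPrime]

/-- The image of `tameHom` is a finite group of units in a domain, hence cyclic, and its kernel is a
`p`-group, which accounts for the factor `p ^ s`. -/
theorem exists_tameHom_generator [Finite G] [FaithfulSMul G S] (hQ : Q ≠ ⊥) {p : ℕ}
    [hp : Fact p.Prime] (hpQ : (p : S) ∈ Q) :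
    ∃ σ₀ : Q.inertia G, (∀ σ, ∃ j : ℕ, tameHom G hQ σ = tameHom G hQ σ₀ ^ j) ∧
      ∃ s : ℕ, Nat.card (Q.inertia G) = p ^ s * orderOf (tameHom G hQ σ₀) := by
  set θ := (tameHom G hQ).toHomUnits
  have hθ (σ : Q.inertia G) : (θ σ : S ⧸ Q) = tameHom G hQ σ := rfl
  have hker : θ.ker = (tameHom G hQ).ker := by
    ext σ
    rw [MonoidHom.mem_ker, MonoidHom.mem_ker, ← hθ, Units.val_eq_one]
  have hinj := QuotientGroup.kerLift_injective θ
  have : IsCyclic (Q.inertia G ⧸ θ.ker) :=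
    isCyclic_of_injective_ringHom ((Units.coeHom (S ⧸ Q)).comp (QuotientGroup.kerLift θ))
      (Units.val_injective.comp hinj)
  obtain ⟨g, hg⟩ := IsCyclic.exists_monoid_generator (α := Q.inertia G ⧸ θ.ker)
  obtain ⟨σ₀, rfl⟩ := QuotientGroup.mk_surjective g
  have hord : orderOf (tameHom G hQ σ₀) = Nat.card (Q.inertia G ⧸ θ.ker) := by
    rw [← orderOf_eq_card_of_forall_mem_zpowers
      (fun x ↦ Submonoid.powers_le_zpowers _ (hg x)), ← orderOf_injective _ hinj, ← hθ,
      orderOf_units]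
    rfl
  refine ⟨σ₀, fun σ ↦ ?_, ?_⟩
  · obtain ⟨j, hj⟩ := hg (QuotientGroup.mk σ)
    refine ⟨j, ?_⟩
    have := congrArg (fun y ↦ (QuotientGroup.kerLift θ y : S ⧸ Q)) hj
    simpa [hθ] using this.symm
  · obtain ⟨s, hs⟩ := IsPGroup.iff_card.mp (isPGroup_ker_tameHom (G := G) hQ hpQ)
    refine ⟨s, ?_⟩
    rw [hord, ← hs, mul_comm, ← hker]
    exact Subgroup.card_eq_card_quotient_mul_card_subgroup _

/-- If `w` is the valuation of `x`, then `x` is nonzero in `Q ^ w / Q ^ (w + 1)`, where `σ` acts by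
the `w`-th power of the tame character. -/
theorem mk_eq_tameHom_pow_multiplicity (hQ : Q ≠ ⊥) {x : S} (hx : x ≠ 0) {σ : Q.inertia G} {c : S}
    (hc : (σ : G) • x = c * x) :
    Ideal.Quotient.mk Q c = tameHom G hQ σ ^ multiplicity Q (Ideal.span {x}) := by
  have hfin : FiniteMultiplicity Q (Ideal.span {x}) :=
    FiniteMultiplicity.of_prime_left (Ideal.prime_of_isPrime hQ inferInstance) (by simpa using hx)
  set w := multiplicity Q (Ideal.span {x})
  have h1 : x ∈ Q ^ w := by
    rw [← Ideal.span_singleton_le_iff_mem, ← Ideal.dvd_iff_le]; exact pow_multiplicity_dvd _ _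
  have h2 : x ∉ Q ^ (w + 1) := by
    rw [← Ideal.span_singleton_le_iff_mem, ← Ideal.dvd_iff_le]
    exact hfin.not_pow_dvd_of_multiplicity_lt (Nat.lt_succ_self _)
  obtain ⟨u, hu⟩ := Ideal.Quotient.mk_surjective (tameHom G hQ σ)
  rw [← hu, ← map_pow]
  refine Ideal.Quotient.eq.mpr (Ideal.mem_prime_of_mul_mem_pow hQ h2 ?_)
  have := smul_sub_pow_mul_mem_of_mk_eq hQ hu w h1
  rw [hc] at this
  convert! this using 1; ring

theorem coprime_pow_sub_one {p : ℕ} (hp : p.Prime) {n : ℕ} (hn : n ≠ 0) :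
    (p ^ n - 1).Coprime p := by
  have h := Nat.coprime_self_sub_left (m := 1) (n := p ^ n) (Nat.one_le_pow _ _ hp.pos)
  have h2 : (p ^ n - 1).Coprime (p ^ n) := by rw [h]; simp
  exact (Nat.coprime_pow_right_iff (Nat.pos_of_ne_zero hn) _ _).mp h2

/-- Both sides are the ramification index: the left one is the valuation of `p = x ^ N`. -/
theorem multiplicity_mul_eq_card_inertia [Finite G] [IsGaloisGroup G ℤ S] [Module.Finite ℤ S]
    [CharZero S] (hQ : Q ≠ ⊥) {p : ℕ} [hp : Fact p.Prime] [Q.LiesOver (Ideal.span {(p : ℤ)})]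
    {N : ℕ} {x : S} (hx : x ^ N = p) :
    N * multiplicity Q (Ideal.span {x}) = Nat.card (Q.inertia G) := by
  have hp0 : (p : ℤ) ≠ 0 := by exact_mod_cast hp.out.ne_zero
  have hpr : (Ideal.span {(p : ℤ)}).IsPrime :=
    (Ideal.span_singleton_prime hp0).mpr (Nat.prime_iff_prime_int.mp hp.out)
  have : Finite (ℤ ⧸ Ideal.span {(p : ℤ)}) := by
    have : NeZero p := ⟨hp.out.ne_zero⟩
    exact Finite.of_equiv _ (Int.quotientSpanNatEquivZMod p).symm.toEquiv
  have hmap : (Ideal.span {(p : ℤ)}).map (algebraMap ℤ S) = Ideal.span {x} ^ N := by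
    rw [Ideal.map_span, Set.image_singleton, Ideal.span_singleton_pow, hx]; simp
  have hx0 : x ^ N ≠ 0 := by rw [hx]; exact_mod_cast hp.out.ne_zero
  have hmap0 : (Ideal.span {(p : ℤ)}).map (algebraMap ℤ S) ≠ ⊥ := by
    rw [hmap, Ideal.span_singleton_pow]; simpa using hx0
  have hN : N ≠ 0 := by
    rintro rfl
    rw [pow_zero] at hx
    exact hp.out.ne_one (by exact_mod_cast hx.symm)
  have hx0' : x ≠ 0 := fun h ↦ hx0 (by rw [h, zero_pow hN])
  have hpQ := Ideal.prime_of_isPrime hQ (inferInstance : Q.IsPrime)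
  have hfin : FiniteMultiplicity Q (Ideal.span {x}) :=
    FiniteMultiplicity.of_prime_left hpQ (by simpa using hx0')
  rw [Ideal.card_inertia_eq_ramificationIdxIn (G := G) (Ideal.span {(p : ℤ)}) Q,
    Ideal.ramificationIdxIn_eq_ramificationIdx (Ideal.span {(p : ℤ)}) Q G,
    Ideal.IsDedekindDomain.ramificationIdx_eq_multiplicity _ _ hmap0, hmap,
    hfin.multiplicity_pow hpQ]

/-- If `x ^ N = p` with `N` prime to `p`, then a generator of tame inertia multiplies `x` by a
primitive `N`-th root of unity modulo `Q`. -/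
theorem isPrimitiveRoot_tameHom_pow [Finite G] [IsGaloisGroup G ℤ S] [Module.Finite ℤ S]
    [CharZero S] (hQ : Q ≠ ⊥) {p : ℕ} [hp : Fact p.Prime] [Q.LiesOver (Ideal.span {(p : ℤ)})]
    {N : ℕ} (hN : N.Coprime p) {x : S} (hx : x ^ N = p) {σ₀ : Q.inertia G} {s : ℕ}
    (hs : Nat.card (Q.inertia G) = p ^ s * orderOf (tameHom G hQ σ₀)) :
    IsPrimitiveRoot (tameHom G hQ σ₀ ^ multiplicity Q (Ideal.span {x})) N := by
  set ζ := tameHom G hQ σ₀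
  set w := multiplicity Q (Ideal.span {x})
  have hmul : N * w = p ^ s * orderOf ζ := by
    rw [← hs]; exact multiplicity_mul_eq_card_inertia hQ hx
  obtain ⟨d, hd⟩ : N ∣ orderOf ζ :=
    (hN.pow_right s).dvd_of_dvd_mul_left ⟨w, hmul.symm⟩
  have hpos : 0 < N * w := by
    rw [show N * w = _ from multiplicity_mul_eq_card_inertia (G := G) hQ hx]; exact Nat.card_pos
  have hN0 : 0 < N := pos_of_mul_pos_left hpos (Nat.zero_le _)
  -- The exponent `d = orderOf ζ / N` produces a primitive `N`-th root of unity, and the remaining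
  -- `p ^ s` is prime to `N`.
  have hw : w = p ^ s * d := by
    rw [hd] at hmul
    exact Nat.eq_of_mul_eq_mul_left hN0 (by rw [hmul]; ring)
  have h0 : 0 < orderOf ζ := by
    rw [hmul] at hpos; exact pos_of_mul_pos_right hpos (Nat.zero_le _)
  have hd' : IsPrimitiveRoot (ζ ^ d) N :=
    (IsPrimitiveRoot.orderOf ζ).pow h0 (by rw [hd, mul_comm])
  rw [hw, mul_comm, pow_mul]
  exact hd'.pow_of_coprime _ (hN.pow_right s).symm

end TameGenerator

/-! ### Lifting decomposition and inertia elements from a normal subextension. -/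

section Lifting

variable {K Ω : Type*} [Field K] [Field Ω] [Algebra K Ω]

theorem continuousSMul_ringOfIntegers [Algebra.IsIntegral K Ω] [TopologicalSpace (𝓞 Ω)]
    [DiscreteTopology (𝓞 Ω)] (H : Subgroup Gal(Ω/K)) : ContinuousSMul H (𝓞 Ω) := by
  rw [continuousSMul_iff_stabilizer_isOpen]
  intro x
  have h := stabilizer_isOpen_of_isIntegral (K := K) (x : Ω)
  convert! h.preimage (continuous_subtype_val (p := (· ∈ H))) using 1
  ext σ
  exact NumberField.RingOfIntegers.ext_iff

variable (L : IntermediateField K Ω)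

theorem smulCommClass_fixingSubgroup : SMulCommClass L.fixingSubgroup (𝓞 L) (𝓞 Ω) where
  smul_comm g a x := by
    have hg : (g : Gal(Ω/K)) • algebraMap (𝓞 L) (𝓞 Ω) a = algebraMap (𝓞 L) (𝓞 Ω) a :=
      NumberField.RingOfIntegers.ext
        ((IntermediateField.mem_fixingSubgroup_iff L _).mp g.2 _ (a : L).2)
    rw [Algebra.smul_def, Algebra.smul_def, Subgroup.smul_def, Subgroup.smul_def, smul_mul', hg]

theorem algebraMap_restrictNormalHom_smul [Normal K L] (g : Gal(Ω/K)) (x : 𝓞 L) :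
    algebraMap (𝓞 L) (𝓞 Ω) (AlgEquiv.restrictNormalHom L g • x) = g • algebraMap (𝓞 L) (𝓞 Ω) x :=
  NumberField.RingOfIntegers.ext (AlgEquiv.restrictNormal_commutes g L x)

theorem under_smul [Normal K L] (𝔓 : Ideal (𝓞 Ω)) (g : Gal(Ω/K)) :
    (g • 𝔓).under (𝓞 L) = AlgEquiv.restrictNormalHom L g • 𝔓.under (𝓞 L) := by
  ext x
  rw [Ideal.mem_pointwise_smul_iff_inv_smul_mem, Ideal.under_def, Ideal.under_def,
    Ideal.mem_comap, Ideal.mem_comap, Ideal.mem_pointwise_smul_iff_inv_smul_mem, ← map_inv,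
    algebraMap_restrictNormalHom_smul]

theorem restrictNormalHom_mem_stabilizer [Normal K L] (𝔓 : Ideal (𝓞 Ω))
    {g : Gal(Ω/K)} (hg : g ∈ MulAction.stabilizer Gal(Ω/K) 𝔓) :
    AlgEquiv.restrictNormalHom L g ∈ MulAction.stabilizer Gal(L/K) (𝔓.under (𝓞 L)) := by
  rw [MulAction.mem_stabilizer_iff, ← under_smul, MulAction.mem_stabilizer_iff.mp hg]

theorem restrictNormalHom_mem_inertia [Normal K L] (𝔓 : Ideal (𝓞 Ω))
    {g : MulAction.stabilizer Gal(Ω/K) 𝔓}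
    (hg : g ∈ 𝔓.inertia (MulAction.stabilizer Gal(Ω/K) 𝔓)) :
    AlgEquiv.restrictNormalHom L (g : Gal(Ω/K)) ∈ (𝔓.under (𝓞 L)).inertia Gal(L/K) := by
  intro x
  change _ ∈ 𝔓.under (𝓞 L)
  rw [Ideal.under_def, Ideal.mem_comap, map_sub, algebraMap_restrictNormalHom_smul]
  exact hg _

variable [IsGalois K Ω]

theorem isInvariant_fixingSubgroup : Algebra.IsInvariant (𝓞 L) (𝓞 Ω) L.fixingSubgroup where
  isInvariant x hx := by
    have hL : (x : Ω) ∈ L := by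
      rw [← InfiniteGalois.fixedField_fixingSubgroup L, IntermediateField.mem_fixedField_iff]
      exact fun f hf ↦ congrArg (fun y : 𝓞 Ω ↦ (y : Ω)) (hx ⟨f, hf⟩)
    have hint : IsIntegral ℤ (⟨x, hL⟩ : L) := by
      rw [← isIntegral_algebraMap_iff (algebraMap L Ω).injective]
      exact x.2
    exact ⟨⟨_, hint⟩, rfl⟩

theorem compactSpace_fixingSubgroup : CompactSpace L.fixingSubgroup :=
  isCompact_iff_compactSpace.mp (InfiniteGalois.fixingSubgroup_isClosed L).isCompact

/-- Primes of `𝓞 Ω` with the same restriction to `L` are conjugate over `L`. -/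
theorem exists_fixingSubgroup_smul_eq (𝔓 𝔓' : Ideal (𝓞 Ω)) [𝔓.IsPrime] [𝔓'.IsPrime]
    (h : 𝔓.under (𝓞 L) = 𝔓'.under (𝓞 L)) : ∃ g ∈ L.fixingSubgroup, 𝔓' = g • 𝔓 := by
  let _ : TopologicalSpace (𝓞 Ω) := ⊥
  have : DiscreteTopology (𝓞 Ω) := ⟨rfl⟩
  have := continuousSMul_ringOfIntegers L.fixingSubgroup
  have := smulCommClass_fixingSubgroup L
  have := isInvariant_fixingSubgroup L
  have := compactSpace_fixingSubgroup L
  obtain ⟨g, hg⟩ := Algebra.IsInvariant.exists_smul_of_under_eq_of_profinite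
    (A := 𝓞 L) (G := L.fixingSubgroup) 𝔓 𝔓' h
  exact ⟨g, g.2, hg⟩

/-- An automorphism of the residue field at `𝔓` that is trivial on the residue field of `L` is
induced by an element of the decomposition group fixing `L`. -/
theorem exists_fixingSubgroup_mk_smul_eq (𝔓 : Ideal (𝓞 Ω)) [𝔓.IsPrime]
    (σ : ((𝓞 Ω) ⧸ 𝔓) ≃ₐ[𝓞 L ⧸ 𝔓.under (𝓞 L)] ((𝓞 Ω) ⧸ 𝔓)) :
    ∃ g ∈ L.fixingSubgroup, g ∈ MulAction.stabilizer Gal(Ω/K) 𝔓 ∧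
      ∀ x : (𝓞 Ω), Ideal.Quotient.mk 𝔓 (g • x) = σ (Ideal.Quotient.mk 𝔓 x) := by
  let _ : TopologicalSpace (𝓞 Ω) := ⊥
  have : DiscreteTopology (𝓞 Ω) := ⟨rfl⟩
  have := continuousSMul_ringOfIntegers L.fixingSubgroup
  have := smulCommClass_fixingSubgroup L
  have := isInvariant_fixingSubgroup L
  have := compactSpace_fixingSubgroup L
  obtain ⟨g, hg⟩ := Ideal.Quotient.stabilizerHom_surjective_of_profinite (G := L.fixingSubgroup)
    (𝔓.under (𝓞 L)) 𝔓 σ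
  refine ⟨g.1, g.1.2, g.2, fun x ↦ ?_⟩
  rw [← hg]
  rfl

variable [Normal K L]

variable (𝔓 : Ideal (𝓞 Ω))

variable [𝔓.IsPrime]

/-- Any lift `g` of `τ` moves `𝔓` to a prime with the same restriction to `L`; an element fixing `L`
moves it back. -/
theorem exists_stabilizer_restrictNormalHom_eq {τ : Gal(L/K)}
    (hτ : τ ∈ MulAction.stabilizer Gal(L/K) (𝔓.under (𝓞 L))) :
    ∃ g ∈ MulAction.stabilizer Gal(Ω/K) 𝔓, AlgEquiv.restrictNormalHom L g = τ := by
  obtain ⟨g, rfl⟩ := AlgEquiv.restrictNormalHom_surjective (F := K) (K₁ := L) Ω τ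
  obtain ⟨h, hh, hP⟩ := exists_fixingSubgroup_smul_eq L (g • 𝔓) 𝔓
    (by rw [under_smul, MulAction.mem_stabilizer_iff.mp hτ])
  refine ⟨h * g, by rw [MulAction.mem_stabilizer_iff, mul_smul, ← hP], ?_⟩
  rw [← L.restrictNormalHom_ker, MonoidHom.mem_ker] at hh
  rw [map_mul, hh, one_mul]

/-- A lift `g` in the decomposition group acts on the residue field of `𝔓` trivially over that of
`L`. Some `h` fixing `L` acts there in the same way, so `h⁻¹ * g` is the inertial lift. -/
theorem exists_inertia_restrictNormalHom_eq {τ : Gal(L/K)}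
    (hτ : τ ∈ (𝔓.under (𝓞 L)).inertia Gal(L/K)) :
    ∃ g ∈ 𝔓.inertia (MulAction.stabilizer Gal(Ω/K) 𝔓),
      AlgEquiv.restrictNormalHom L (g : Gal(Ω/K)) = τ := by
  obtain ⟨g, hg, rfl⟩ := exists_stabilizer_restrictNormalHom_eq L 𝔓
    (Ideal.inertia_le_stabilizer _ hτ)
  let φ := Ideal.Quotient.stabilizerHom 𝔓 (𝔓.under ℤ) Gal(Ω/K) ⟨g, hg⟩
  let σ : ((𝓞 Ω) ⧸ 𝔓) ≃ₐ[𝓞 L ⧸ 𝔓.under (𝓞 L)] ((𝓞 Ω) ⧸ 𝔓) :=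
    AlgEquiv.ofRingEquiv (f := φ.toRingEquiv) (by
      intro x
      obtain ⟨x, rfl⟩ := Ideal.Quotient.mk_surjective x
      change Ideal.Quotient.mk 𝔓 (g • algebraMap (𝓞 L) (𝓞 Ω) x) =
        Ideal.Quotient.mk 𝔓 (algebraMap (𝓞 L) (𝓞 Ω) x)
      rw [← algebraMap_restrictNormalHom_smul, Ideal.Quotient.eq, ← map_sub]
      exact hτ x)
  obtain ⟨h, hh, hP, hx⟩ := exists_fixingSubgroup_mk_smul_eq L 𝔓 σ
  rw [← L.restrictNormalHom_ker, MonoidHom.mem_ker] at hh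
  refine ⟨⟨h⁻¹ * g, mul_mem (inv_mem hP) hg⟩, fun x ↦ ?_, ?_⟩
  · have h1 : g • x - h • x ∈ 𝔓 := by
      rw [← Ideal.Quotient.eq, hx]; rfl
    have h2 : h⁻¹ • (g • x - h • x) ∈ h⁻¹ • 𝔓 := Ideal.smul_mem_pointwise_smul _ _ _ h1
    rw [MulAction.mem_stabilizer_iff.mp (inv_mem hP), smul_sub, inv_smul_smul, ← mul_smul] at h2
    exact h2
  · rw [map_mul, map_inv, hh, inv_one, one_mul]

end Lifting

/-! ### Linear algebra of the relation `T E = E T ^ p`. -/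

section CyclicEigenbasis

open Module

variable {k V : Type*} [Field k] [AddCommGroup V] [Module k V]

theorem exists_pow_prime_pow_eq_self (p : ℕ) [Fact p.Prime] [Algebra (ZMod p) k]
    [Algebra.IsAlgebraic (ZMod p) k] (a : k) : ∃ d, 0 < d ∧ a ^ p ^ d = a := by
  have : FiniteDimensional (ZMod p) (IntermediateField.adjoin (ZMod p) {a}) :=
    IntermediateField.adjoin.finiteDimensional (Algebra.IsIntegral.isIntegral a)
  have : Finite (IntermediateField.adjoin (ZMod p) {a}) := Module.finite_of_finite (ZMod p)
  have := Fintype.ofFinite (IntermediateField.adjoin (ZMod p) {a})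
  refine ⟨finrank (ZMod p) (IntermediateField.adjoin (ZMod p) {a}), finrank_pos, ?_⟩
  have h := FiniteField.pow_card
    (⟨a, IntermediateField.mem_adjoin_simple_self (ZMod p) a⟩ :
      IntermediateField.adjoin (ZMod p) {a})
  rw [Module.card_eq_pow_finrank (K := ZMod p), ZMod.card] at h
  exact congrArg Subtype.val h

theorem apply_pow_eq_smul {E T : End k V} {p : ℕ} (h : T * E = E * T ^ p) {a : k} {v : V}
    (hv : T v = a • v) (i : ℕ) : T ((E ^ i) v) = a ^ p ^ i • (E ^ i) v := by
  induction i with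
  | zero => simpa using hv
  | succ i ih =>
    have hpow (j : ℕ) : (T ^ j) ((E ^ i) v) = (a ^ p ^ i) ^ j • (E ^ i) v := by
      induction j with
      | zero => simp
      | succ j ihj => rw [pow_succ', Module.End.mul_apply, ihj, map_smul, ih, smul_smul, pow_succ]
    rw [pow_succ', Module.End.mul_apply, ← Module.End.mul_apply, h, Module.End.mul_apply, hpow,
      map_smul, ← pow_mul, ← pow_succ]

/-- If `T E = E T ^ p` and no proper subspace is stable under `T` and `E`, then `T` is
diagonalizable with eigenvalues `a, a ^ p, a ^ (p ^ 2), …`. -/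
theorem exists_basis_eigenvalues_prime_pow (p : ℕ) [Fact p.Prime] [CharP k p] [Algebra (ZMod p) k]
    [IsAlgClosed k] [Algebra.IsAlgebraic (ZMod p) k] [FiniteDimensional k V] [Nontrivial V]
    {E T : End k V} (hE : Function.Injective E) (hT : Function.Injective T)
    (h : T * E = E * T ^ p)
    (hirr : ∀ U : Submodule k V, U ≠ ⊥ → (∀ v ∈ U, E v ∈ U) → (∀ v ∈ U, T v ∈ U) → U = ⊤) :
    ∃ (b : Basis (Fin (finrank k V)) k V) (a : k), a ^ (p ^ finrank k V - 1) = 1 ∧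
      ∀ i, T (b i) = a ^ p ^ (i : ℕ) • b i := by
  classical
  obtain ⟨a, ha⟩ := End.exists_eigenvalue T
  have hex := exists_pow_prime_pow_eq_self p a
  obtain ⟨hd0, hda⟩ := Nat.find_spec hex
  have hmin (j : ℕ) (hj : 0 < j) (hj' : j < Nat.find hex) : a ^ p ^ j ≠ a :=
    fun h' ↦ Nat.find_min hex hj' ⟨hj, h'⟩
  generalize Nat.find hex = d at hd0 hda hmin
  have hmaps : ∀ v ∈ End.eigenspace T a, (E ^ d) v ∈ End.eigenspace T a := fun v hv ↦ by
    rw [End.mem_eigenspace_iff] at hv ⊢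
    rw [apply_pow_eq_smul h hv, hda]
  have : Nontrivial (End.eigenspace T a) := Submodule.nontrivial_iff_ne_bot.mpr ha
  -- Since `E ^ d` preserves the `a`-eigenspace, `v` can be an eigenvector of both `T` and `E ^ d`;
  -- this closes up the `E`-orbit of the line through `v`.
  obtain ⟨c, hc⟩ := End.exists_eigenvalue ((E ^ d).restrict hmaps)
  obtain ⟨⟨v, hv⟩, hvc⟩ := hc.exists_hasEigenvector
  have hv0 : v ≠ 0 := fun h0 ↦ hvc.2 (Subtype.ext h0)
  have hEd : (E ^ d) v = c • v := congrArg Subtype.val hvc.apply_eq_smul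
  rw [End.mem_eigenspace_iff] at hv
  have hEinj (i : ℕ) : Function.Injective (E ^ i) := by
    rw [End.coe_pow]; exact hE.iterate i
  have hb0 (i : ℕ) : (E ^ i) v ≠ 0 := fun h0 ↦ hv0 (hEinj i (by rw [h0, map_zero]))
  have ha0 : a ≠ 0 := by
    rintro rfl
    exact hv0 (hT (by rw [hv, zero_smul, map_zero]))
  -- Undoing `i` Frobenius steps would give `a ^ p ^ (j - i) = a`, against minimality of `d`.
  have key (i j : ℕ) (hij : i < j) (hj : j < d) : a ^ p ^ i ≠ a ^ p ^ j := fun heq ↦ by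
    refine hmin (j - i) (by lia) (by lia) (iterateFrobenius_inj k p i ?_)
    rw [iterateFrobenius_def, iterateFrobenius_def, ← pow_mul, ← pow_add, heq,
      Nat.sub_add_cancel hij.le]
  have hinj : Function.Injective fun i : Fin d ↦ a ^ p ^ (i : ℕ) := fun i j hij ↦ by
    rcases lt_trichotomy (i : ℕ) j with hlt | heq | hlt
    · exact absurd hij (key _ _ hlt j.2)
    · exact Fin.ext heq
    · exact absurd hij.symm (key _ _ hlt i.2)
  have hli : LinearIndependent k fun i : Fin d ↦ (E ^ (i : ℕ)) v :=
    End.eigenvectors_linearIndependent' T (fun i : Fin d ↦ a ^ p ^ (i : ℕ)) hinj _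
      fun i ↦ ⟨End.mem_eigenspace_iff.mpr (apply_pow_eq_smul h hv i), hb0 i⟩
  have hspan : Submodule.span k (Set.range fun i : Fin d ↦ (E ^ (i : ℕ)) v) = ⊤ := by
    set U := Submodule.span k (Set.range fun i : Fin d ↦ (E ^ (i : ℕ)) v)
    have hmem (i : ℕ) (hi : i < d) : (E ^ i) v ∈ U := Submodule.subset_span ⟨⟨i, hi⟩, rfl⟩
    have stable (A : End k V) (hA : ∀ i < d, A ((E ^ i) v) ∈ U) : ∀ u ∈ U, A u ∈ U := by
      change U ≤ U.comap A
      rw [Submodule.span_le]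
      rintro _ ⟨i, rfl⟩
      exact hA i i.2
    refine hirr U ?_ (stable E fun i hi ↦ ?_) (stable T fun i hi ↦ ?_)
    · intro hbot
      have := hmem 0 hd0
      rw [hbot, Submodule.mem_bot] at this
      exact hb0 0 this
    · rw [← End.mul_apply, ← pow_succ']
      rcases Nat.lt_or_ge (i + 1) d with hlt | hge
      · exact hmem _ hlt
      · rw [show i + 1 = d by lia, hEd]
        exact Submodule.smul_mem _ _ (by simpa using hmem 0 hd0)
    · rw [apply_pow_eq_smul h hv]
      exact Submodule.smul_mem _ _ (hmem i hi)
  let b := Basis.mk hli hspan.ge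
  have hfin : finrank k V = d := by rw [finrank_eq_card_basis b, Fintype.card_fin]
  refine ⟨b.reindex (finCongr hfin.symm), a, ?_, fun i ↦ ?_⟩
  · rw [hfin]
    refine mul_right_cancel₀ ha0 ?_
    rw [← pow_succ, Nat.sub_add_cancel (Nat.one_le_pow _ _ (Fact.out : p.Prime).pos), one_mul, hda]
  · rw [Basis.reindex_apply, Basis.mk_apply]
    exact apply_pow_eq_smul h hv i

end CyclicEigenbasis

/-! ### Fixed vectors of `p`-groups in characteristic `p`. -/

section FixedVectors

variable {k V : Type*} [Field k] [AddCommGroup V] [Module k V]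

/-- The `𝔽_p`-span of one orbit is finite, nonzero and stable, so `p` divides its order. The number
of fixed points is then divisible by `p`, and `0` cannot be the only one. -/
theorem exists_fixed_of_isPGroup_of_zmodModule {p : ℕ} [hp : Fact p.Prime] [Module (ZMod p) V]
    [Nontrivial V] (P : Subgroup (V →ₗ[k] V)ˣ) [Finite P] (hP : IsPGroup p P) :
    ∃ v : V, v ≠ 0 ∧ ∀ g ∈ P, (g : V →ₗ[k] V) v = v := by
  obtain ⟨v, hv⟩ := exists_ne (0 : V)
  have hpV (x : V) : p • x = 0 := by
    rw [← Nat.cast_smul_eq_nsmul (ZMod p), CharP.cast_eq_zero, zero_smul]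
  let A : Submodule (ZMod p) V :=
    Submodule.span (ZMod p) (Set.range fun g : P ↦ ((g : (V →ₗ[k] V)ˣ) : V →ₗ[k] V) v)
  have : Finite A := by
    have : Module.Finite (ZMod p) A :=
      Module.Finite.span_of_finite (ZMod p) (Set.finite_range _)
    exact Module.finite_of_finite (ZMod p)
  have hstab (g : P) (a : V) (ha : a ∈ A) : ((g : (V →ₗ[k] V)ˣ) : V →ₗ[k] V) a ∈ A := by
    let f : V →ₗ[ZMod p] V :=
      (((g : (V →ₗ[k] V)ˣ) : V →ₗ[k] V).toAddMonoidHom).toZModLinearMap p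
    change a ∈ A.comap f
    revert a
    change A ≤ A.comap f
    refine Submodule.span_le.mpr ?_
    rintro _ ⟨h, rfl⟩
    exact Submodule.subset_span ⟨g * h, rfl⟩
  let _ : MulAction P A :=
    { smul g a := ⟨((g : (V →ₗ[k] V)ˣ) : V →ₗ[k] V) a, hstab g a a.2⟩
      one_smul _ := rfl
      mul_smul _ _ _ := rfl }
  have hvA : v ∈ A := Submodule.subset_span ⟨1, rfl⟩
  have hdvd : p ∣ Nat.card A := by
    have : addOrderOf (⟨v, hvA⟩ : A) = p :=
      addOrderOf_eq_prime (Subtype.ext (hpV v)) fun h ↦ hv (congrArg Subtype.val h)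
    exact this.symm.dvd.trans (addOrderOf_dvd_natCard _)
  obtain ⟨⟨w, hwA⟩, hw, hw0⟩ :=
    hP.exists_fixed_point_of_prime_dvd_card_of_fixed_point A hdvd (a := 0)
      (fun g ↦ Subtype.ext (map_zero ((g : (V →ₗ[k] V)ˣ) : V →ₗ[k] V)))
  exact ⟨w, fun h ↦ hw0 (Subtype.ext h.symm), fun g hg ↦ congrArg Subtype.val (hw ⟨g, hg⟩)⟩

theorem exists_fixed_of_isPGroup {p : ℕ} [hp : Fact p.Prime] [CharP k p] [Nontrivial V]
    (P : Subgroup (V →ₗ[k] V)ˣ) [Finite P] (hP : IsPGroup p P) :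
    ∃ v : V, v ≠ 0 ∧ ∀ g ∈ P, (g : V →ₗ[k] V) v = v := by
  have hpV (x : V) : p • x = 0 := by
    rw [← Nat.cast_smul_eq_nsmul k, CharP.cast_eq_zero, zero_smul]
  let _ : Module (ZMod p) V := AddCommGroup.zmodModule hpV
  exact exists_fixed_of_isPGroup_of_zmodModule P hP

theorem Representation.IsIrreducible.eq_top_of_ne_bot {G : Type*} [Monoid G]
    {ρ : Representation k G V} (hρ : ρ.IsIrreducible) {U : Submodule k V} (hU : U ≠ ⊥)
    (h : ∀ g, ∀ v ∈ U, ρ g v ∈ U) : U = ⊤ := by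
  let S : Subrepresentation ρ := ⟨U, fun g v hv ↦ h g v hv⟩
  rcases eq_bot_or_eq_top S with hS | hS
  · exact absurd (congrArg Subrepresentation.toSubmodule hS) hU
  · exact congrArg Subrepresentation.toSubmodule hS

theorem Representation.IsIrreducible.nontrivial {G : Type*} [Monoid G]
    {ρ : Representation k G V} (hρ : ρ.IsIrreducible) : Nontrivial V := by
  by_contra h
  rw [not_nontrivial_iff_subsingleton] at h
  obtain ⟨S, T, hST⟩ := exists_pair_ne (Subrepresentation ρ)
  exact hST (Subrepresentation.toSubmodule_injective (Subsingleton.elim _ _))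

/-- A normal subgroup acting through a finite `p`-group acts trivially on an irreducible
representation in characteristic `p`. -/
theorem Representation.IsIrreducible.eq_one_of_pow_prime_pow {p : ℕ} [Fact p.Prime] [CharP k p]
    {G : Type*} [Group G] {ρ : Representation k G V} (hρ : ρ.IsIrreducible)
    (hfin : (Set.range ρ).Finite) (W : Subgroup G) [W.Normal]
    (hW : ∀ w ∈ W, ∃ m : ℕ, ρ w ^ p ^ m = 1) {w : G} (hw : w ∈ W) : ρ w = 1 := by
  have := hρ.nontrivial
  let P : Subgroup (V →ₗ[k] V)ˣ := W.map ρ.asGroupHom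
  have hPρ (u : G) : ((ρ.asGroupHom u : (V →ₗ[k] V)ˣ) : V →ₗ[k] V) = ρ u := rfl
  have : Finite P := by
    have := hfin.to_subtype
    refine Finite.of_injective (β := Set.range ρ) (fun g ↦ ⟨((g : (V →ₗ[k] V)ˣ) : V →ₗ[k] V), ?_⟩)
      fun g h hgh ↦ Subtype.ext (Units.ext (congrArg Subtype.val hgh))
    obtain ⟨u, _, hu⟩ := g.2
    exact ⟨u, by rw [← hu, hPρ]⟩
  have hP : IsPGroup p P := by
    rintro ⟨_, u, hu, rfl⟩
    obtain ⟨m, hm⟩ := hW u hu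
    exact ⟨m, Subtype.ext (Units.ext hm)⟩
  obtain ⟨v, hv0, hv⟩ := exists_fixed_of_isPGroup P hP
  -- The `W`-fixed vectors form a subspace stable under all of `G` because `W` is normal.
  let U : Submodule k V :=
    { carrier := {x | ∀ u ∈ W, ρ u x = x}
      add_mem' := fun hx hy u hu ↦ by rw [map_add, hx u hu, hy u hu]
      zero_mem' := fun u _ ↦ map_zero _
      smul_mem' := fun c x hx u hu ↦ by rw [map_smul, hx u hu] }
  have hU : U = ⊤ := by
    refine hρ.eq_top_of_ne_bot ((Submodule.ne_bot_iff U).mpr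
      ⟨v, fun u hu ↦ hv _ (Subgroup.mem_map_of_mem _ hu), hv0⟩) fun g x hx u hu ↦ ?_
    have h1 := hx (g⁻¹ * u * g) (by simpa using ‹W.Normal›.conj_mem u hu g⁻¹)
    have h2 : u * g = g * (g⁻¹ * u * g) := by group
    rw [← Module.End.mul_apply, ← map_mul, h2, map_mul, Module.End.mul_apply, h1]
  ext x
  exact (hU ▸ Submodule.mem_top : x ∈ U) w hw

end FixedVectors

/-! ### Frobenius elements of the decomposition group. -/

section Frobenius

theorem exists_pow_prime_pow_eq_apply {κ : Type*} [Field κ] [Finite κ] (p : ℕ) [Fact p.Prime]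
    [CharP κ p] (f : κ →+* κ) : ∃ j : ℕ, ∀ x, f x = x ^ p ^ j := by
  let _ : Algebra (ZMod p) κ := ZMod.algebra κ p
  let f' : κ →ₐ[ZMod p] κ :=
    { f with
      commutes' := RingHom.congr_fun
        (Subsingleton.elim (f.comp (algebraMap (ZMod p) κ)) (algebraMap (ZMod p) κ)) }
  obtain ⟨j, hj⟩ := (FiniteField.bijective_frobeniusAlgHom_pow (ZMod p) κ).2 f'
  refine ⟨j, fun x ↦ ?_⟩
  have hpow (i : ℕ) : (FiniteField.frobeniusAlgHom (ZMod p) κ ^ i) x = x ^ p ^ i := by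
    induction i with
    | zero => simp
    | succ i ih =>
      rw [pow_succ', AlgHom.mul_apply, ih, FiniteField.frobeniusAlgHom_apply, ZMod.card, ← pow_mul,
        ← pow_succ]
  exact (AlgHom.congr_fun hj x).symm.trans (hpow j)

variable {S G : Type*} [CommRing S] [Group G] [MulSemiringAction G S] {Q : Ideal S}

theorem natCast_mem_of_liesOver {p : ℕ} [Q.LiesOver (Ideal.span {(p : ℤ)})] : (p : S) ∈ Q := by
  have h := (Ideal.mem_of_liesOver Q (Ideal.span {(p : ℤ)}) (p : ℤ)).mp
    (Ideal.mem_span_singleton_self _)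
  simpa using h

variable [Q.IsPrime]

theorem charP_quotient {p : ℕ} [hp : Fact p.Prime] (hpQ : (p : S) ∈ Q) : CharP (S ⧸ Q) p := by
  have h0 : (p : S ⧸ Q) = 0 := by
    rw [← map_natCast (Ideal.Quotient.mk Q)]
    exact Ideal.Quotient.eq_zero_iff_mem.mpr hpQ
  obtain ⟨q, hq⟩ := CharP.exists (S ⧸ Q)
  rcases (Nat.dvd_prime hp.out).mp ((CharP.cast_eq_zero_iff (S ⧸ Q) q p).mp h0) with h | h
  · exact absurd h (CharP.char_ne_one (S ⧸ Q) q)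
  · exact h ▸ hq

attribute [local instance] Ideal.Quotient.field in
/-- The stabilizer of a prime above `p` is generated by a Frobenius element and inertia. -/
theorem exists_frobenius_of_liesOver [Finite G] [IsGaloisGroup G ℤ S] [Finite (S ⧸ Q)]
    {p : ℕ} [hp : Fact p.Prime] [hQ : Q.LiesOver (Ideal.span {(p : ℤ)})] :
    ∃ F ∈ MulAction.stabilizer G Q, (∀ x, F • x - x ^ p ∈ Q) ∧
      ∀ τ ∈ MulAction.stabilizer G Q, ∃ j : ℕ, (F ^ j)⁻¹ * τ ∈ Q.inertia G := by
  have : Q.IsMaximal := Ideal.Quotient.maximal_of_isField _ (Finite.isField_of_domain (S ⧸ Q))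
  have := charP_quotient (Q := Q) (p := p) natCast_mem_of_liesOver
  obtain ⟨F, hF⟩ := IsArithFrobAt.exists_of_isInvariant ℤ G Q
  have hcard : Nat.card (ℤ ⧸ Q.under ℤ) = p := by
    rw [← hQ.over, Nat.card_congr (Int.quotientSpanNatEquivZMod p).toEquiv, Nat.card_zmod]
  have hF' (x : S) : F • x - x ^ p ∈ Q := by
    have := hF x
    rwa [hcard] at this
  have hstab := hF.mem_stabilizer
  refine ⟨F, hstab, hF', fun τ hτ ↦ ?_⟩
  -- On the finite residue field `τ` acts as a power of Frobenius, so `F ^ j` and `τ` differ by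
  -- inertia.
  obtain ⟨j, hj⟩ := exists_pow_prime_pow_eq_apply p
    (Ideal.Quotient.stabilizerHom Q (Q.under ℤ) G ⟨τ, hτ⟩ : S ⧸ Q →+* S ⧸ Q)
  have hFj (i : ℕ) (x : S) : (F ^ i) • x - x ^ p ^ i ∈ Q := by
    induction i generalizing x with
    | zero => simp
    | succ i ih =>
      have h1 := ih (F • x)
      have h2 : (F • x) ^ p ^ i - (x ^ p) ^ p ^ i ∈ Q := by
        rw [← Ideal.Quotient.eq, map_pow, map_pow (Ideal.Quotient.mk Q) (x ^ p),
          Ideal.Quotient.eq.mpr (hF' x)]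
      rw [← pow_mul, ← pow_succ'] at h2
      rw [pow_succ, mul_smul]
      simpa using add_mem h1 h2
  refine ⟨j, fun x ↦ ?_⟩
  have h1 : τ • x - x ^ p ^ j ∈ Q := by
    rw [← Ideal.Quotient.eq, map_pow]
    exact hj (Ideal.Quotient.mk Q x)
  have h2 : τ • x - (F ^ j) • x ∈ Q := by simpa using sub_mem h1 (hFj j x)
  have h3 : (F ^ j)⁻¹ • (τ • x - (F ^ j) • x) ∈ Q ^ 1 :=
    smul_mem_pow_of_mem_stabilizer (inv_mem (pow_mem hstab j)) (by simpa using h2)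
  simpa [smul_sub, mul_smul] using h3

end Frobenius

/-! ### Finite normal layers of `ℚ̄`. -/

section Normal

open Topology IntermediateField

theorem exists_normal_mem_fixingSubgroup_subset {K Ω : Type*} [Field K] [Field Ω] [Algebra K Ω]
    [Normal K Ω] (x : Ω) {s : Set Gal(Ω/K)} (hs : s ∈ 𝓝 1) :
    ∃ L : IntermediateField K Ω, FiniteDimensional K L ∧ Normal K L ∧ x ∈ L ∧
      (L.fixingSubgroup : Set Gal(Ω/K)) ⊆ s := by
  obtain ⟨E, _, hE⟩ := (krullTopology_mem_nhds_one_iff K Ω s).mp hs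
  have : FiniteDimensional K K⟮x⟯ :=
    adjoin.finiteDimensional (Algebra.IsIntegral.isIntegral x)
  have hle := (E ⊔ K⟮x⟯).le_normalClosure
  exact ⟨IntermediateField.normalClosure K ↥(E ⊔ K⟮x⟯) Ω, normalClosure.is_finiteDimensional _ _ _,
    normalClosure.normal _ _ _, hle (le_sup_right (a := E) (mem_adjoin_simple_self K x)),
    subset_trans (fixingSubgroup_antitone (le_sup_left.trans hle)) hE⟩

theorem isGalois_Qbar : IsGalois ℚ Qbar := by
  have h : @IsAlgClosure ℚ (AlgebraicClosure ℚ) _ _ (AlgebraicClosure.instAlgebra ℚ) _ :=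
    inferInstance
  have : IsAlgClosure ℚ Qbar := by convert! h
  exact IsAlgClosure.isGalois ℚ Qbar

theorem numberField_of_finiteDimensional (E : Type*) [Field E] [Algebra ℚ E]
    [FiniteDimensional ℚ E] : NumberField E :=
  have := algebraRat.charZero E
  { to_finiteDimensional := by
      convert! ‹FiniteDimensional ℚ E›
      exact Subsingleton.elim _ _ }

theorem isGaloisGroup_ringOfIntegers (E : Type*) [Field E] [Algebra ℚ E]
    [FiniteDimensional ℚ E] [Normal ℚ E] : IsGaloisGroup Gal(E/ℚ) ℤ (𝓞 E) := by
  have : IsGalois ℚ E := { }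
  have h : IsGaloisGroup Gal(E/ℚ) ℚ E := IsGaloisGroup.of_isGalois ℚ E
  have := numberField_of_finiteDimensional E
  exact IsGaloisGroup.of_isFractionRing (hGKL := h) Gal(E/ℚ) ℤ (𝓞 E) ℚ E

end Normal

/-! ### Decomposition group modulo wild inertia at a finite layer. -/

section TameInertia

variable {K Ω : Type*} [Field K] [Field Ω] [Algebra K Ω]

theorem conj_mem_inertia {S G : Type*} [CommRing S] [Group G] [MulSemiringAction G S]
    {Q : Ideal S} {F σ : G} (hF : F ∈ MulAction.stabilizer G Q) (hσ : σ ∈ Q.inertia G) :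
    F * σ * F⁻¹ ∈ Q.inertia G := by
  intro x
  have h : F • (σ • F⁻¹ • x - F⁻¹ • x) ∈ Q ^ 1 :=
    smul_mem_pow_of_mem_stabilizer hF (by simpa using hσ (F⁻¹ • x))
  simpa [smul_sub, mul_smul] using h

/-- Restriction of a decomposition group to a normal subextension. -/
noncomputable def stabilizerRestrict (L : IntermediateField K Ω) [Normal K L] (𝔓 : Ideal (𝓞 Ω)) :
    MulAction.stabilizer Gal(Ω/K) 𝔓 →* Gal(L/K) :=
  (AlgEquiv.restrictNormalHom L).comp (Subgroup.subtype _)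

theorem mem_fixingSubgroup_of_stabilizerRestrict_eq_one {L : IntermediateField K Ω} [Normal K L]
    {𝔓 : Ideal (𝓞 Ω)} {g : MulAction.stabilizer Gal(Ω/K) 𝔓} (hg : stabilizerRestrict L 𝔓 g = 1) :
    (g : Gal(Ω/K)) ∈ L.fixingSubgroup := by
  rw [← L.restrictNormalHom_ker]
  exact hg

/-- The structure of the image of a decomposition group in a finite quotient `Gal(L/K)` modulo
wild inertia, for `L` containing an `N`-th root `ϖ` of `p` with `N` prime to `p`: tame inertia is
generated by an element `σ₀` acting on `ϖ` by a primitive `N`-th root of unity, and a Frobenius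
element acts on it by raising to the power `p`. -/
theorem exists_tame_generator_frobenius [IsGalois K Ω] (L : IntermediateField K Ω)
    [FiniteDimensional K L] [Normal K L] [NumberField L] [IsGaloisGroup Gal(L/K) ℤ (𝓞 L)]
    {p : ℕ} [hp : Fact p.Prime] (𝔓 : Ideal (𝓞 Ω)) [𝔓.IsPrime]
    [𝔓.LiesOver (Ideal.span {(p : ℤ)})] {N : ℕ} (hN : N.Coprime p) {ϖ : Ω} (hϖ : ϖ ^ N = p)
    (hϖL : ϖ ∈ L) (χ : 𝔓.inertia (MulAction.stabilizer Gal(Ω/K) 𝔓) →* 𝓞 Ω ⧸ 𝔓)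
    (hχ : ∀ (σ : 𝔓.inertia (MulAction.stabilizer Gal(Ω/K) 𝔓)) (c : 𝓞 Ω),
      ((σ : MulAction.stabilizer Gal(Ω/K) 𝔓) : Gal(Ω/K)) ϖ = c * ϖ →
      χ σ = Ideal.Quotient.mk 𝔓 c) :
    ∃ (σ₀ : 𝔓.inertia (MulAction.stabilizer Gal(Ω/K) 𝔓)) (F : MulAction.stabilizer Gal(Ω/K) 𝔓)
      (W : Subgroup (MulAction.stabilizer Gal(Ω/K) 𝔓)),
      W.Normal ∧
      (∀ w ∈ W, ∃ m : ℕ, stabilizerRestrict L 𝔓 w ^ p ^ m = 1) ∧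
      IsPrimitiveRoot (χ σ₀) N ∧
      (∀ σ : 𝔓.inertia (MulAction.stabilizer Gal(Ω/K) 𝔓), ∃ j : ℕ,
        ((σ₀ : MulAction.stabilizer Gal(Ω/K) 𝔓) ^ j)⁻¹ * σ ∈ W ∧
        χ σ = χ σ₀ ^ j) ∧
      ((σ₀ : MulAction.stabilizer Gal(Ω/K) 𝔓) ^ p)⁻¹ * (F * σ₀ * F⁻¹) ∈ W ∧
      ∀ g : MulAction.stabilizer Gal(Ω/K) 𝔓, ∃ (j : ℕ)
          (σ : 𝔓.inertia (MulAction.stabilizer Gal(Ω/K) 𝔓)),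
        stabilizerRestrict L 𝔓 g = stabilizerRestrict L 𝔓 (F ^ j * σ) := by
  let D := MulAction.stabilizer Gal(Ω/K) 𝔓
  set Q := 𝔓.under (𝓞 L) with hQdef
  have hLO : Q.LiesOver (Ideal.span {(p : ℤ)}) :=
    ⟨by rw [hQdef, Ideal.under_under]; exact Ideal.LiesOver.over⟩
  have hpQ : (p : 𝓞 L) ∈ Q := natCast_mem_of_liesOver
  have hQ : Q ≠ ⊥ := by
    intro h
    rw [h, Ideal.mem_bot] at hpQ
    exact hp.out.ne_zero (by exact_mod_cast hpQ)
  have : Finite (𝓞 L ⧸ Q) := Ideal.finiteQuotientOfFreeOfNeBot Q hQ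
  have hfaith : FaithfulSMul Gal(L/K) (𝓞 L) := IsGaloisGroup.faithful ℤ
  let r : D →* Gal(L/K) := stabilizerRestrict L 𝔓
  let rI : 𝔓.inertia D →* Q.inertia Gal(L/K) :=
    (r.comp (𝔓.inertia D).subtype).codRestrict _ fun σ ↦ restrictNormalHom_mem_inertia L 𝔓 σ.2
  have hrI (σ) : (rI σ : Gal(L/K)) = r σ := rfl
  let θ : 𝔓.inertia D →* 𝓞 L ⧸ Q := (tameHom Gal(L/K) hQ).comp rI
  -- `W` is the preimage in inertia of the wild inertia of `L`; it contains also the inertia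
  -- elements that fix `L`.
  let W : Subgroup D := θ.ker.map (𝔓.inertia D).subtype
  have hWmem (σ : 𝔓.inertia D) (hσ : θ σ = 1) : (σ : D) ∈ W := ⟨σ, hσ, rfl⟩
  have hWeq (σ τ : 𝔓.inertia D) (j : ℕ) (h : θ τ = θ σ ^ j) : ((σ : D) ^ j)⁻¹ * τ ∈ W := by
    have h1 : θ ((σ ^ j)⁻¹ * τ) = 1 := by
      rw [map_mul, h, ← map_pow, ← map_mul, inv_mul_cancel, map_one]
    have h2 := hWmem _ h1
    rwa [Subgroup.coe_mul, Subgroup.coe_inv, Subgroup.coe_pow] at h2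
  have hDI (g : D) (σ : 𝔓.inertia D) : g * σ * g⁻¹ ∈ 𝔓.inertia D :=
    conj_mem_inertia (MulAction.mem_stabilizer_iff.mp g.2) σ.2
  have hconj (g : D) (σ : 𝔓.inertia D) {u : 𝓞 L} (hu : Ideal.Quotient.mk Q u = θ σ) :
      θ ⟨g * σ * g⁻¹, hDI g σ⟩ = Ideal.Quotient.mk Q (r g • u) :=
    tameHom_conj hQ (F := r g) (restrictNormalHom_mem_stabilizer L 𝔓 g.2)
      (by rw [hrI, hrI, map_mul, map_mul, map_inv]) hu
  have hN0 : N ≠ 0 := by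
    rintro rfl
    exact hp.out.ne_one ((Nat.coprime_zero_left p).mp hN)
  -- A general `m` covers both `ϖ` itself (`m = p`) and the root of unity `σ(ϖ)/ϖ` (`m = 1`).
  have hint {E : Type _} [Field E] {y : E} {m : ℕ} (hy : y ^ N = m) : IsIntegral ℤ y :=
    IsIntegral.of_pow (Nat.pos_of_ne_zero hN0) (by rw [hy]; exact isIntegral_natCast m)
  have hϖ' : (⟨ϖ, hϖL⟩ : L) ^ N = p := Subtype.ext hϖ
  let x : 𝓞 L := ⟨⟨ϖ, hϖL⟩, hint hϖ'⟩
  have hx : x ^ N = p := NumberField.RingOfIntegers.ext hϖ'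
  have hx0 : x ≠ 0 := by
    intro h
    rw [h, zero_pow hN0] at hx
    exact hp.out.ne_zero (by exact_mod_cast hx.symm)
  have hx0' : (x : L) ≠ 0 := fun h ↦ hx0 (NumberField.RingOfIntegers.ext h)
  set w := multiplicity Q (Ideal.span {x})
  let ι : 𝓞 L ⧸ Q →+* 𝓞 Ω ⧸ 𝔓 := Ideal.quotientMap 𝔓 (algebraMap (𝓞 L) (𝓞 Ω)) le_rfl
  have hι : Function.Injective ι := Ideal.quotientMap_injective
  have hχθ (σ : 𝔓.inertia D) : χ σ = ι (θ σ ^ w) := by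
    have hy : (((r σ • x : 𝓞 L) : L) / x) ^ N = (1 : ℕ) := by
      rw [div_pow, ← map_pow, ← map_pow, ← smul_pow', hx,
        show r σ • (p : 𝓞 L) = p from map_natCast (MulSemiringAction.toRingHom _ _ (r σ)) p,
        map_natCast, Nat.cast_one, div_self (Nat.cast_ne_zero.mpr hp.out.ne_zero)]
    let c : 𝓞 L := ⟨((r σ • x : 𝓞 L) : L) / x, hint hy⟩
    have hc : r σ • x = c * x :=
      NumberField.RingOfIntegers.ext (div_mul_cancel₀ _ hx0').symm
    rw [hχ σ (algebraMap (𝓞 L) (𝓞 Ω) c)]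
    · exact congrArg ι (mk_eq_tameHom_pow_multiplicity hQ hx0 (σ := rI σ) hc)
    · have := congrArg (fun y : 𝓞 Ω ↦ (y : Ω)) (congrArg (algebraMap (𝓞 L) (𝓞 Ω)) hc)
      rw [map_mul] at this
      exact (congrArg (fun y : 𝓞 Ω ↦ (y : Ω))
        (algebraMap_restrictNormalHom_smul L (σ : Gal(Ω/K)) x)).symm.trans this
  obtain ⟨τ₀, hτ₀, s, hs⟩ := exists_tameHom_generator (G := Gal(L/K)) hQ hpQ
  obtain ⟨F₀, hF₀, hFrob, hFgen⟩ := exists_frobenius_of_liesOver (G := Gal(L/K)) (Q := Q) (p := p)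
  obtain ⟨σ₀, hσ₀, hσ₀'⟩ := exists_inertia_restrictNormalHom_eq L 𝔓 τ₀.2
  obtain ⟨F, hF, rfl⟩ := exists_stabilizer_restrictNormalHom_eq L 𝔓 hF₀
  have hrσ₀ : rI ⟨σ₀, hσ₀⟩ = τ₀ := Subtype.ext hσ₀'
  have hθσ₀ : θ ⟨σ₀, hσ₀⟩ = tameHom Gal(L/K) hQ τ₀ := congrArg (tameHom Gal(L/K) hQ) hrσ₀
  refine ⟨⟨σ₀, hσ₀⟩, ⟨F, hF⟩, W, ⟨?_⟩, ?_, ?_, fun σ ↦ ?_, ?_, fun g ↦ ?_⟩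
  · rintro _ ⟨σ, hσ, rfl⟩ g
    refine hWmem ⟨g * σ * g⁻¹, hDI g σ⟩ ?_
    rw [hconj g σ (u := 1) (by rw [map_one]; exact hσ.symm), smul_one, map_one]
  · rintro _ ⟨σ, hσ, rfl⟩
    obtain ⟨m, hm⟩ := isPGroup_ker_tameHom (G := Gal(L/K)) hQ hpQ ⟨rI σ, hσ⟩
    exact ⟨m, congrArg (fun y ↦ ((y : Q.inertia Gal(L/K)) : Gal(L/K))) (congrArg Subtype.val hm)⟩
  · rw [hχθ, hθσ₀]
    exact (isPrimitiveRoot_tameHom_pow hQ hN hx hs).map_of_injective hι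
  · obtain ⟨j, hj⟩ := hτ₀ (rI σ)
    have hj' : θ σ = θ ⟨σ₀, hσ₀⟩ ^ j := by rw [hθσ₀]; exact hj
    refine ⟨j, hWeq ⟨σ₀, hσ₀⟩ σ j hj', ?_⟩
    rw [hχθ, hχθ, hj', ← map_pow ι, ← pow_mul, ← pow_mul, mul_comm]
  · obtain ⟨u, hu⟩ := Ideal.Quotient.mk_surjective (θ ⟨σ₀, hσ₀⟩)
    refine hWeq ⟨σ₀, hσ₀⟩ ⟨_, hDI ⟨F, hF⟩ ⟨σ₀, hσ₀⟩⟩ p ?_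
    -- Conjugation by `F` acts on values of `θ` through the residue field, where `F` is the `p`-th
    -- power map.
    rw [hconj ⟨F, hF⟩ ⟨σ₀, hσ₀⟩ hu, ← hu, ← map_pow]
    exact Ideal.Quotient.eq.mpr (hFrob u)
  · obtain ⟨j, hj⟩ := hFgen _ (restrictNormalHom_mem_stabilizer L 𝔓 g.2)
    obtain ⟨σ, hσ, hσ'⟩ := exists_inertia_restrictNormalHom_eq L 𝔓 hj
    refine ⟨j, ⟨σ, hσ⟩, ?_⟩
    change AlgEquiv.restrictNormalHom L (g : Gal(Ω/K)) =
      AlgEquiv.restrictNormalHom L (F ^ j * (σ : Gal(Ω/K)))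
    rw [map_mul, hσ', map_pow, mul_inv_cancel_left]

end TameInertia

/-! ### The fundamental characters and the main theorem. -/

section Main

theorem tameCharacter_eq_mk_of_apply_eq_mul (p : ℕ) [Fact p.Prime] (n : ℕ) [NeZero n]
    (𝔓 : Ideal Zbar) (σ : inertiaGroup 𝔓) (c : Zbar)
    (hc : ((σ : decompositionGroup 𝔓) : GQ) (uniformizerRoot p n) = c * uniformizerRoot p n) :
    tameCharacter p n 𝔓 σ = Ideal.Quotient.mk 𝔓 c := by
  have h : kummerRoot p n ((σ : decompositionGroup 𝔓) : GQ) = c :=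
    NumberField.RingOfIntegers.ext ((div_eq_iff (uniformizerRoot_ne_zero p n)).mpr hc)
  exact congrArg (Ideal.Quotient.mk 𝔓) h

theorem fundamentalCharacter_val (p : ℕ) [Fact p.Prime] (n : ℕ) [NeZero n]
    (𝔓 : Ideal Zbar) {k : Type*} [Field k] [CharP k p] (ι : Zbar ⧸ 𝔓 →+* k) (i : Fin n)
    (σ : inertiaGroup 𝔓) :
    (fundamentalCharacter p n 𝔓 ι i σ : k) = ι (tameCharacter p n 𝔓 σ) ^ p ^ (i : ℕ) := rfl

end Main

theorem lemma2p16 (p : ℕ) [Fact p.Prime]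
    -- `k` is an algebraic closure of `𝔽_p`
    (k : Type*) [Field k] [CharP k p] [Algebra (ZMod p) k] [IsAlgClosure (ZMod p) k]
    -- a prime of `ℤ̄` above `p`, and an embedding of its residue field into `k`
    (𝔓 : Ideal Zbar) [𝔓.IsPrime] [𝔓.LiesOver (Ideal.span {(p : ℤ)})]
    (ι : Zbar ⧸ 𝔓 →+* k)
    -- a simple `n`-dimensional continuous representation of the decomposition group
    (n : ℕ) [NeZero n]
    (V : Type*) [AddCommGroup V] [Module k V] [FiniteDimensional k V]
    (hn : Module.finrank k V = n)
    (ρ : Representation k (decompositionGroup 𝔓) V)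
    -- continuity, for the discrete topology on the target
    (hcont : IsLocallyConstant (fun g : decompositionGroup 𝔓 => ρ g))
    (hsimple : ρ.IsIrreducible) :
    ∃ (b : Module.Basis (Fin n) k V) (φ : Fin n → (inertiaGroup 𝔓 →* kˣ)),
      (∀ σ : inertiaGroup 𝔓,
        LinearMap.toMatrix b b (ρ (σ : decompositionGroup 𝔓)) =
          Matrix.diagonal (fun i => (φ i σ : k))) ∧
      ∃ (m : ℤ) (π : Equiv.Perm (Fin n)),
        ∀ i, φ i = fundamentalCharacter p n 𝔓 ι (π i) ^ m := by
  have := isGalois_Qbar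
  have : IsAlgClosed k := IsAlgClosure.isAlgClosed (ZMod p)
  have : Algebra.IsAlgebraic (ZMod p) k := IsAlgClosure.isAlgebraic
  have hopen : {g : decompositionGroup 𝔓 | ρ g = 1} ∈ nhds 1 :=
    (hcont.isOpen_fiber 1).mem_nhds (map_one ρ)
  obtain ⟨s, hs, hsub⟩ := mem_nhds_subtype _ _ _ |>.mp hopen
  obtain ⟨L, hL, hLn, hmem, hLs⟩ :=
    exists_normal_mem_fixingSubgroup_subset (uniformizerRoot p n) hs
  have := @numberField_of_finiteDimensional L _ L.algebra' hL
  have := @isGaloisGroup_ringOfIntegers L _ L.algebra' hL hLn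
  obtain ⟨σ₀, F, W, hW, hWp, hprim, hgen, hFrob, hD⟩ := exists_tame_generator_frobenius L 𝔓
    (coprime_pow_sub_one (Fact.out : p.Prime) (NeZero.ne n)) (uniformizerRoot_pow p n) hmem
    (tameCharacter p n 𝔓) (tameCharacter_eq_mk_of_apply_eq_mul p n 𝔓)
  let r := stabilizerRestrict L 𝔓
  have hr (g : decompositionGroup 𝔓) (hg : r g = 1) : ρ g = 1 :=
    hsub (hLs (mem_fixingSubgroup_of_stabilizerRestrict_eq_one hg))
  have hr' (g h : decompositionGroup 𝔓) (hgh : r g = r h) : ρ g = ρ h := by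
    have h1 := hr (h⁻¹ * g) (by rw [map_mul, map_inv, hgh, inv_mul_cancel])
    rw [← mul_one (ρ h), ← h1, ← map_mul, mul_inv_cancel_left]
  have hρW {w} (hw : w ∈ W) : ρ w = 1 := by
    refine hsimple.eq_one_of_pow_prime_pow (p := p) ?_ W (fun w hw ↦ ?_) hw
    · refine Set.Finite.subset (Set.finite_range fun y : Set.range r ↦ ρ y.2.choose) ?_
      rintro _ ⟨g, rfl⟩
      exact ⟨⟨r g, g, rfl⟩, hr' _ _ (Exists.choose_spec (⟨g, rfl⟩ : r g ∈ Set.range r))⟩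
    · obtain ⟨m, hm⟩ := hWp w hw
      exact ⟨m, by rw [← map_pow]; exact hr _ (by rw [map_pow]; exact hm)⟩
  have hρI (σ : inertiaGroup 𝔓) : ∃ j : ℕ, ρ σ = ρ σ₀ ^ j ∧
      tameCharacter p n 𝔓 σ = tameCharacter p n 𝔓 σ₀ ^ j := by
    obtain ⟨j, hj, hj'⟩ := hgen σ
    refine ⟨j, ?_, hj'⟩
    rw [← mul_one (ρ σ₀ ^ j), ← hρW hj, ← map_pow, ← map_mul, mul_inv_cancel_left]
  -- Modulo `W`, `F σ₀ F⁻¹ = σ₀ ^ p`; hence `F⁻¹`, not `F`, plays the role of `E`.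
  have hrel : ρ σ₀ * ρ F⁻¹ = ρ F⁻¹ * ρ σ₀ ^ p := by
    rw [← mul_one (_ * ρ σ₀ ^ p), ← hρW hFrob, ← map_pow, ← map_mul, ← map_mul, ← map_mul]
    congr 1; group
  have hinj (g : decompositionGroup 𝔓) : Function.Injective (ρ g) :=
    (ρ.apply_bijective g).injective
  have := hsimple.nontrivial
  obtain ⟨b, a, ha, hb⟩ := exists_basis_eigenvalues_prime_pow p (hinj F⁻¹) (hinj σ₀) hrel
    (fun U hU hUE hUT ↦ by
      refine hsimple.eq_top_of_ne_bot hU fun g v hv ↦ ?_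
      obtain ⟨j, σ, hg⟩ := hD g
      obtain ⟨i, hi, -⟩ := hρI σ
      have hpow {A : V →ₗ[k] V} (hA : ∀ v ∈ U, A v ∈ U) (l : ℕ) : ∀ v ∈ U, (A ^ l) v ∈ U := by
        induction l with
        | zero => exact fun v hv ↦ hv
        | succ l ih =>
          intro v hv
          rw [pow_succ', Module.End.mul_apply]
          exact hA _ (ih v hv)
      -- `F` has finite order in `Gal(L/ℚ)`, so `ρ F` is a power of `ρ F⁻¹` and stability under the
      -- latter suffices.
      have hF : ρ F = ρ F⁻¹ ^ (orderOf (r F) - 1) := by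
        rw [← map_pow]
        refine hr' _ _ ?_
        rw [map_pow, map_inv, inv_pow, eq_inv_iff_mul_eq_one, ← pow_succ',
          Nat.sub_add_cancel (orderOf_pos (r F)), pow_orderOf_eq_one]
      rw [hr' g _ hg, map_mul, map_pow, hi, Module.End.mul_apply]
      exact hpow (hF ▸ hpow hUE _) j _ (hpow hUT i v hv))
  subst hn
  -- The residue ring is a field, so `ι` is injective and preserves primitive roots of unity.
  have : 𝔓.IsMaximal := Ideal.IsMaximal.of_liesOver_isMaximal 𝔓 (Ideal.span {(p : ℤ)})
  let _ := Ideal.Quotient.field 𝔓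
  have hψ := hprim.map_of_injective ι.injective
  have hN := prime_pow_sub_one_pos p (Module.finrank k V)
  have : NeZero (p ^ Module.finrank k V - 1) := ⟨hN.ne'⟩
  obtain ⟨m, -, hm⟩ := hψ.eq_pow_of_pow_eq_one ha
  -- No reordering is needed: basis vectors and characters are both indexed by the exponent of `p ^
  -- i`.
  refine ⟨b, fun i ↦ fundamentalCharacter p _ 𝔓 ι i ^ (m : ℤ), fun σ ↦ ?_, m, Equiv.refl _,
    fun i ↦ rfl⟩
  obtain ⟨j, hj, hj'⟩ := hρI σ
  have hbj (i) : (ρ σ₀ ^ j) (b i) = (a ^ p ^ (i : ℕ)) ^ j • b i := by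
    clear hj hj'
    induction j with
    | zero => simp
    | succ j ih => rw [pow_succ', Module.End.mul_apply, ih, map_smul, hb, smul_smul, pow_succ]
  ext i l
  rw [LinearMap.toMatrix_apply, hj, hbj, map_smul, Module.Basis.repr_self, Matrix.diagonal_apply]
  rcases eq_or_ne i l with rfl | hil
  · simp [fundamentalCharacter_val, hj', ← hm, ← pow_mul]
    ring_nf
  · simp [hil]
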